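/- Let $S_3^n$ ($n\ge 1$) be the Sierpiński graph whose vertices are the words $i_1\cdots i_n$ of length $n$ over $\{0,1,2\}$, two words $i_1\cdots i_n$ and $j_1\cdots j_n$ being adjacent if there is an index $h\in\{1,\dots,n\}$ such that $i_t=j_t$ for all $t<h$, $i_h\ne j_h$, and $i_t=j_h$, $j_t=i_h$ for all $t>h$. A set $X$ of vertices of a graph $G$ is a general position set if for all $u,v\in X$ every shortest $u,v$-path $P$ satisfies $V(P)\cap X\subseteq\{u,v\}$; the general position number $\mathrm{gp}(G)$ of a finite graph $G$ is the largest cardinality of a general position set of $G$. Then for every integer $n\ge 2$, $$\mathrm{gp}(S_3^n)=3^{n-2}+3.$$ -/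

import Mathlib

/-- `X` is a general position set of `G`: for all `u, v ∈ X`, every shortest `u,v`-path meets `X`
in at most the vertices `u` and `v`. -/
def SimpleGraph.IsGeneralPosition {V : Type*} (G : SimpleGraph V) (X : Set V) : Prop :=
  ∀ u ∈ X, ∀ v ∈ X, ∀ P : G.Walk u v, P.IsPath → P.length = G.dist u v →
    ∀ w ∈ P.support, w ∈ X → w = u ∨ w = v

/-- The Sierpiński graph `S_p^n`: the vertices are the words of length `n` over `{0, …, p - 1}`. -/
def sierpinskiGraph (p n : ℕ) : SimpleGraph (Fin n → Fin p) where
  Adj u v := ∃ h : Fin n, (∀ t, t < h → u t = v t) ∧ u h ≠ v h ∧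
    ∀ t, h < t → u t = v h ∧ v t = u h
  symm := ⟨by
    rintro u v ⟨h, h₁, h₂, h₃⟩
    exact ⟨h, fun t ht => (h₁ t ht).symm, h₂.symm, fun t ht => (h₃ t ht).symm⟩⟩
  loopless := ⟨by
    rintro u ⟨h, -, h₂, -⟩
    exact h₂ rfl⟩

/-- The general position number of a finite graph: the largest size of a general position set. -/
noncomputable def SimpleGraph.gpNumber {V : Type*} [Finite V] (G : SimpleGraph V) : ℕ :=
  sSup {k | ∃ X : Set V, G.IsGeneralPosition X ∧ X.ncard = k}

/-! `S_3^(n+1)` is three copies of `S_3^n`, one per first letter, any two joined by one edge between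
extreme vertices. A geodesic between two copies uses their edge or detours along a side of the third
copy, so distances obey a recursion (`sierpinskiGraph_dist`), and general position says that no word
lies metrically between two others.

Upper bound: induct on the length, slicing `X` by the first letter. If geodesics from slice `i` to
slice `j` use the edge between them, then the corner `j⋯j` of slice `i` acts like an extra point of
that slice (`CornerFree`). Hence the stronger claim `|X| + |A| ≤ 3^r + 3` for a set `A` of at most
two such corners: a slice with two of them has at most `3^r + 1` words, and three such slices give
`3^(r+1) + 3`. If slice `i` is not corner-free towards `j`, some word of it reaches slice `j` only
by detours (`WordGeneralPosition.exists_detour`); then slice `j` is `Leaning` and has at most `3^r`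
words, which pays for the excess. A slice with all three corners loses one more word because it also
avoids two sides (`SideFree`). The three bounds in `WordUpperBounds` are carried together.

Lower bound: for length at least three, take the words ending in `i, i+1, i+2` and the three
constant words. The former lie on no side of any copy of `S_3^m`, `m ≥ 3`, that contains them
(`EndsCyclic.two_pow_lt`), so geodesics crossing a copy miss them; an extreme vertex is never inside
a geodesic (`wordDist_lt_cornerDist_add`). -/

open Matrix (vecCons)

/-! ### Recursive distance formulas on words. -/

section WordMetric

/-- The distance in `S_3^n` from the vertex `u` to the extreme vertex `a⋯a`. -/
def cornerDist : {n : ℕ} → (Fin n → Fin 3) → Fin 3 → ℕ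
  | 0, _, _ => 0
  | n + 1, u, a => (if u 0 = a then 0 else 2 ^ n) + cornerDist (Fin.tail u) a

/-- The distance in `S_3^n` between two words, by recursion on their length. -/
def wordDist : {n : ℕ} → (Fin n → Fin 3) → (Fin n → Fin 3) → ℕ
  | 0, _, _ => 0
  | n + 1, u, v =>
    if u 0 = v 0 then wordDist (Fin.tail u) (Fin.tail v)
    else min (cornerDist (Fin.tail u) (v 0) + 1 + cornerDist (Fin.tail v) (u 0))
      -- As `0 + 1 + 2 = 0` in `Fin 3`, the negated sum is the third letter. The detour costs two
      -- joining edges and a side of length `2^n - 1`, in total `1 + 2^n`.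
      (cornerDist (Fin.tail u) (-(u 0 + v 0)) + 1 + 2 ^ n +
        cornerDist (Fin.tail v) (-(u 0 + v 0)))

theorem exists_eq_vecCons {α : Type*} {n : ℕ} (u : Fin (n + 1) → α) :
    ∃ i u', u = vecCons i u' :=
  ⟨u 0, Fin.tail u, (Fin.cons_self_tail u).symm⟩

theorem vecCons_eq_vecCons_iff {α : Type*} {n : ℕ} {i j : α} {u v : Fin n → α} :
    vecCons i u = vecCons j v ↔ i = j ∧ u = v :=
  Fin.cons_inj

theorem const_succ_eq_vecCons {α : Type*} {n : ℕ} (a : α) :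
    (fun _ : Fin (n + 1) => a) = vecCons a (fun _ : Fin n => a) := by
  funext t
  refine Fin.cases ?_ (fun s => ?_) t <;> simp

theorem neg_add_eq_of_distinct {i j k : Fin 3} (hij : i ≠ j) (hik : i ≠ k) (hjk : j ≠ k) :
    -(i + j) = k := by
  revert i j k; decide

theorem exists_distinct_third {i j : Fin 3} (hij : i ≠ j) : ∃ k, i ≠ k ∧ j ≠ k := by
  revert i j; decide

theorem eq_or_eq_or_eq_of_distinct {i j k : Fin 3} (hij : i ≠ j) (hik : i ≠ k) (hjk : j ≠ k)
    (l : Fin 3) : l = i ∨ l = j ∨ l = k := by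
  revert i j k l; decide

variable {n : ℕ}

theorem cornerDist_vecCons (i a : Fin 3) (u : Fin n → Fin 3) :
    cornerDist (vecCons i u) a = (if i = a then 0 else 2 ^ n) + cornerDist u a := rfl

theorem cornerDist_vecCons_self (a : Fin 3) (u : Fin n → Fin 3) :
    cornerDist (vecCons a u) a = cornerDist u a := by
  simp [cornerDist_vecCons]

theorem cornerDist_vecCons_of_ne {i a : Fin 3} (h : i ≠ a) (u : Fin n → Fin 3) :
    cornerDist (vecCons i u) a = 2 ^ n + cornerDist u a := by
  simp [cornerDist_vecCons, h]

theorem wordDist_vecCons_self (i : Fin 3) (u v : Fin n → Fin 3) :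
    wordDist (vecCons i u) (vecCons i v) = wordDist u v := by
  rw [wordDist]; simp

theorem wordDist_vecCons_of_ne {i j k : Fin 3} (hij : i ≠ j) (hik : i ≠ k) (hjk : j ≠ k)
    (u v : Fin n → Fin 3) :
    wordDist (vecCons i u) (vecCons j v) =
      min (cornerDist u j + 1 + cornerDist v i)
        (cornerDist u k + 1 + 2 ^ n + cornerDist v k) := by
  obtain rfl := neg_add_eq_of_distinct hij hik hjk
  rw [wordDist]
  simp [hij]

theorem cornerDist_lt (u : Fin n → Fin 3) (a : Fin 3) : cornerDist u a < 2 ^ n := by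
  induction n with
  | zero => simp [cornerDist]
  | succ n ih =>
    obtain ⟨i, u, rfl⟩ := exists_eq_vecCons u
    have := ih u
    rw [cornerDist_vecCons, pow_succ]
    split_ifs <;> omega

theorem cornerDist_const_self (a : Fin 3) : cornerDist (fun _ : Fin n => a) a = 0 := by
  induction n with
  | zero => rfl
  | succ n ih => rw [const_succ_eq_vecCons, cornerDist_vecCons_self, ih]

theorem cornerDist_const_of_ne {a b : Fin 3} (h : a ≠ b) :
    cornerDist (fun _ : Fin n => a) b + 1 = 2 ^ n := by
  induction n with
  | zero => rfl
  | succ n ih => rw [const_succ_eq_vecCons, cornerDist_vecCons_of_ne h, pow_succ]; omega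

theorem eq_const_of_cornerDist_eq_zero {u : Fin n → Fin 3} {a : Fin 3}
    (h : cornerDist u a = 0) : u = fun _ => a := by
  induction n with
  | zero => exact Subsingleton.elim _ _
  | succ n ih =>
    obtain ⟨i, u, rfl⟩ := exists_eq_vecCons u
    have hp : 0 < 2 ^ n := by positivity
    rw [cornerDist_vecCons] at h
    split_ifs at h with hi
    · rw [const_succ_eq_vecCons, hi, ih (u := u) (by omega)]
    · omega

/-- Each letter is charged for exactly the two corners it differs from, so the sum is `2(2^n - 1)`.
Lying on a side thus means being at the maximal distance `2^n - 1` from the opposite corner. -/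
theorem cornerDist_sum {i j k : Fin 3} (hij : i ≠ j) (hik : i ≠ k) (hjk : j ≠ k)
    (u : Fin n → Fin 3) :
    cornerDist u i + cornerDist u j + cornerDist u k + 2 = 2 * 2 ^ n := by
  induction n with
  | zero => rfl
  | succ n ih =>
    obtain ⟨l, u, rfl⟩ := exists_eq_vecCons u
    have := ih u
    simp only [cornerDist_vecCons, pow_succ]
    rcases eq_or_eq_or_eq_of_distinct hij hik hjk l with rfl | rfl | rfl
    · simp only [if_true, if_neg hij, if_neg hik]; omega
    · simp only [if_true, if_neg hij.symm, if_neg hjk]; omega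
    · simp only [if_true, if_neg hik.symm, if_neg hjk.symm]; omega

theorem wordDist_const (u : Fin n → Fin 3) (a : Fin 3) :
    wordDist u (fun _ => a) = cornerDist u a := by
  induction n with
  | zero => rfl
  | succ n ih =>
    obtain ⟨i, u, rfl⟩ := exists_eq_vecCons u
    rw [const_succ_eq_vecCons]
    by_cases hi : i = a
    · subst hi
      rw [wordDist_vecCons_self, cornerDist_vecCons_self, ih]
    · obtain ⟨k, hk, hk'⟩ := exists_distinct_third hi
      rw [wordDist_vecCons_of_ne hi hk hk', cornerDist_vecCons_of_ne hi]
      have h₁ := cornerDist_const_of_ne (n := n) (Ne.symm hi)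
      have h₂ := cornerDist_const_of_ne (n := n) hk'
      have := cornerDist_lt u a
      omega

theorem wordDist_self (u : Fin n → Fin 3) : wordDist u u = 0 := by
  induction n with
  | zero => rfl
  | succ n ih =>
    obtain ⟨i, u, rfl⟩ := exists_eq_vecCons u
    rw [wordDist_vecCons_self, ih]

theorem wordDist_lt (u v : Fin n → Fin 3) : wordDist u v < 2 ^ n := by
  induction n with
  | zero => simp [wordDist]
  | succ n ih =>
    obtain ⟨i, u, rfl⟩ := exists_eq_vecCons u
    obtain ⟨j, v, rfl⟩ := exists_eq_vecCons v
    rw [pow_succ]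
    by_cases hij : i = j
    · subst hij
      rw [wordDist_vecCons_self]
      have := ih u v
      omega
    · obtain ⟨k, hk, hk'⟩ := exists_distinct_third hij
      rw [wordDist_vecCons_of_ne hij hk hk']
      have := cornerDist_lt u j
      have := cornerDist_lt v i
      omega

end WordMetric

/-! ### The word metric is the graph distance. -/

section Adjacency

variable {n : ℕ}

theorem sierpinskiGraph_adj_vecCons {p : ℕ} {i j : Fin p} {u v : Fin n → Fin p} :
    (sierpinskiGraph p (n + 1)).Adj (vecCons i u) (vecCons j v) ↔
      (i = j ∧ (sierpinskiGraph p n).Adj u v) ∨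
        (i ≠ j ∧ u = (fun _ => j) ∧ v = fun _ => i) := by
  constructor
  · rintro ⟨h, h₁, h₂, h₃⟩
    induction h using Fin.cases with
    | zero =>
      refine Or.inr ⟨by simpa using h₂, ?_, ?_⟩ <;> funext t
      · simpa using (h₃ t.succ (Fin.succ_pos t)).1
      · simpa using (h₃ t.succ (Fin.succ_pos t)).2
    | succ h =>
      refine Or.inl ⟨by simpa using h₁ 0 (Fin.succ_pos h), h, fun t ht => ?_, by simpa using h₂,
        fun t ht => ?_⟩
      · simpa using h₁ t.succ (Fin.succ_lt_succ_iff.2 ht)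
      · simpa using h₃ t.succ (Fin.succ_lt_succ_iff.2 ht)
  · rintro (⟨rfl, h, h₁, h₂, h₃⟩ | ⟨hij, rfl, rfl⟩)
    · refine ⟨h.succ, fun t ht => ?_, by simpa using h₂, fun t ht => ?_⟩
      · induction t using Fin.cases with
        | zero => rfl
        | succ t => simpa using h₁ t (Fin.succ_lt_succ_iff.1 ht)
      · induction t using Fin.cases with
        | zero => simp at ht
        | succ t => simpa using h₃ t (Fin.succ_lt_succ_iff.1 ht)
    · refine ⟨0, fun t ht => by simp at ht, by simpa using hij, fun t ht => ?_⟩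
      induction t using Fin.cases with
      | zero => simp at ht
      | succ t => simp

/-- Prepending a letter embeds `S_p^n` into `S_p^(n+1)`. -/
def sierpinskiGraphConsHom (p n : ℕ) (i : Fin p) :
    sierpinskiGraph p n →g sierpinskiGraph p (n + 1) where
  toFun u := vecCons i u
  map_rel' h := sierpinskiGraph_adj_vecCons.2 (Or.inl ⟨rfl, h⟩)

theorem exists_walk_length_eq_wordDist (u v : Fin n → Fin 3) :
    ∃ P : (sierpinskiGraph 3 n).Walk u v, P.length = wordDist u v := by
  induction n with
  | zero =>
    obtain rfl := Subsingleton.elim u v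
    exact ⟨.nil, rfl⟩
  | succ n ih =>
    have lift (i : Fin 3) (x y : Fin n → Fin 3) :
        ∃ P : (sierpinskiGraph 3 (n + 1)).Walk (vecCons i x) (vecCons i y),
          P.length = wordDist x y := by
      obtain ⟨P, hP⟩ := ih x y
      exact ⟨P.map (sierpinskiGraphConsHom 3 n i), (SimpleGraph.Walk.length_map _ _).trans hP⟩
    have edge {i j : Fin 3} (hij : i ≠ j) : (sierpinskiGraph 3 (n + 1)).Adj
        (vecCons i fun _ => j) (vecCons j fun _ => i) :=
      sierpinskiGraph_adj_vecCons.2 (Or.inr ⟨hij, rfl, rfl⟩)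
    obtain ⟨i, u, rfl⟩ := exists_eq_vecCons u
    obtain ⟨j, v, rfl⟩ := exists_eq_vecCons v
    by_cases hij : i = j
    · subst hij
      rw [wordDist_vecCons_self]
      exact lift i u v
    obtain ⟨k, hik, hjk⟩ := exists_distinct_third hij
    rw [wordDist_vecCons_of_ne hij hik hjk]
    rcases min_choice (cornerDist u j + 1 + cornerDist v i)
      (cornerDist u k + 1 + 2 ^ n + cornerDist v k) with h | h <;> rw [h]
    · obtain ⟨P, hP⟩ := lift i u fun _ => j
      obtain ⟨Q, hQ⟩ := lift j v fun _ => i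
      rw [wordDist_const] at hP hQ
      refine ⟨(P.concat (edge hij)).append Q.reverse, ?_⟩
      simp [hP, hQ]
    · obtain ⟨P, hP⟩ := lift i u fun _ => k
      obtain ⟨Q, hQ⟩ := lift j v fun _ => k
      obtain ⟨R, hR⟩ := lift k (fun _ => i) fun _ => j
      rw [wordDist_const] at hP hQ hR
      have := cornerDist_const_of_ne (n := n) hij
      refine ⟨((P.concat (edge hik)).append (R.concat (edge hjk.symm))).append Q.reverse, ?_⟩
      simp only [SimpleGraph.Walk.length_append, SimpleGraph.Walk.length_concat,
        SimpleGraph.Walk.length_reverse, hP, hQ, hR]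
      omega

theorem cornerDist_le_of_adj {u v : Fin n → Fin 3} (h : (sierpinskiGraph 3 n).Adj u v)
    (a : Fin 3) : cornerDist u a ≤ cornerDist v a + 1 := by
  induction n with
  | zero => exact absurd (Subsingleton.elim u v) h.ne
  | succ n ih =>
    obtain ⟨i, u, rfl⟩ := exists_eq_vecCons u
    obtain ⟨j, v, rfl⟩ := exists_eq_vecCons v
    rcases sierpinskiGraph_adj_vecCons.1 h with ⟨rfl, h'⟩ | ⟨hij, rfl, rfl⟩
    · have := ih h'
      simp only [cornerDist_vecCons]
      omega
    · rw [cornerDist_vecCons, cornerDist_vecCons]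
      have h₁ := cornerDist_lt (fun _ : Fin n => j) a
      by_cases hi : i = a
      · subst hi; rw [if_pos rfl, if_neg hij.symm]; omega
      rw [if_neg hi]
      have h₂ := cornerDist_const_of_ne (n := n) hi
      by_cases hj : j = a
      · subst hj
        rw [if_pos rfl, cornerDist_const_self]; omega
      · rw [if_neg hj]; omega

/-- This Lipschitz property makes the recursive formula a lower bound for the length of every walk.
-/
theorem wordDist_le_of_adj (u : Fin n → Fin 3) {v w : Fin n → Fin 3}
    (h : (sierpinskiGraph 3 n).Adj v w) : wordDist u v ≤ wordDist u w + 1 := by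
  induction n with
  | zero => exact absurd (Subsingleton.elim v w) h.ne
  | succ n ih =>
    obtain ⟨i, u, rfl⟩ := exists_eq_vecCons u
    obtain ⟨j, v, rfl⟩ := exists_eq_vecCons v
    obtain ⟨l, w, rfl⟩ := exists_eq_vecCons w
    rcases sierpinskiGraph_adj_vecCons.1 h with ⟨rfl, h'⟩ | ⟨hjl, rfl, rfl⟩
    · by_cases hij : i = j
      · subst hij
        rw [wordDist_vecCons_self, wordDist_vecCons_self]
        exact ih u h'
      · obtain ⟨k, hik, hjk⟩ := exists_distinct_third hij
        rw [wordDist_vecCons_of_ne hij hik hjk, wordDist_vecCons_of_ne hij hik hjk]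
        have := cornerDist_le_of_adj h' i
        have := cornerDist_le_of_adj h' k
        omega
    · by_cases hij : i = j
      · subst hij
        obtain ⟨k, hik, hlk⟩ := exists_distinct_third hjl
        rw [wordDist_vecCons_self, wordDist_vecCons_of_ne hjl hik hlk, wordDist_const,
          cornerDist_const_self]
        have := cornerDist_lt u l
        omega
      by_cases hil : i = l
      · subst hil
        obtain ⟨k, hik, hlk⟩ := exists_distinct_third hij
        rw [wordDist_vecCons_self, wordDist_vecCons_of_ne hij hik hlk, wordDist_const,
          cornerDist_const_self]
        have := cornerDist_lt u j
        omega
      -- Seen from the third copy, the direct route to one end of the edge and the detour to the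
      -- other end differ only by the edge itself.
      · rw [wordDist_vecCons_of_ne hij hil hjl, wordDist_vecCons_of_ne hil hij hjl.symm,
          cornerDist_const_self, cornerDist_const_self]
        have := cornerDist_const_of_ne (n := n) (Ne.symm hil)
        have := cornerDist_const_of_ne (n := n) (Ne.symm hij)
        omega

theorem wordDist_le_length {u v : Fin n → Fin 3} (P : (sierpinskiGraph 3 n).Walk u v) :
    wordDist u v ≤ P.length := by
  suffices ∀ x, wordDist x v ≤ wordDist x u + P.length by simpa [wordDist_self] using this u
  intro x
  induction P with
  | nil => simp
  | cons h P ih =>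
    have := wordDist_le_of_adj x h.symm
    rw [SimpleGraph.Walk.length_cons]
    omega

theorem sierpinskiGraph_connected : (sierpinskiGraph 3 n).Connected :=
  (SimpleGraph.connected_iff _).2
    ⟨fun u v => ⟨(exists_walk_length_eq_wordDist u v).choose⟩, inferInstance⟩

theorem sierpinskiGraph_dist (u v : Fin n → Fin 3) :
    (sierpinskiGraph 3 n).dist u v = wordDist u v := by
  obtain ⟨P, hP⟩ := exists_walk_length_eq_wordDist u v
  obtain ⟨Q, hQ⟩ := (sierpinskiGraph_connected.preconnected u v).exists_walk_length_eq_dist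
  exact le_antisymm (hP ▸ SimpleGraph.dist_le P) (hQ ▸ wordDist_le_length Q)

theorem wordDist_comm (u v : Fin n → Fin 3) : wordDist u v = wordDist v u := by
  rw [← sierpinskiGraph_dist, SimpleGraph.dist_comm, sierpinskiGraph_dist]

theorem wordDist_triangle (u v w : Fin n → Fin 3) :
    wordDist u w ≤ wordDist u v + wordDist v w := by
  simpa only [sierpinskiGraph_dist] using
    sierpinskiGraph_connected.dist_triangle (u := u) (v := v) (w := w)

theorem cornerDist_triangle (u v : Fin n → Fin 3) (a : Fin 3) :
    cornerDist u a ≤ wordDist u v + cornerDist v a := by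
  simpa only [wordDist_const] using wordDist_triangle u v fun _ => a

end Adjacency

/-! ### General position as a betweenness condition. -/

section GeneralPosition

theorem SimpleGraph.Connected.isGeneralPosition_iff {V : Type*} {G : SimpleGraph V}
    (hG : G.Connected) {X : Set V} :
    G.IsGeneralPosition X ↔ ∀ u ∈ X, ∀ v ∈ X, ∀ w ∈ X,
      G.dist u w + G.dist w v = G.dist u v → w = u ∨ w = v := by
  classical
  constructor
  · intro h u hu v hv w hw hd
    obtain ⟨P, hP⟩ := (hG.preconnected u w).exists_walk_length_eq_dist
    obtain ⟨Q, hQ⟩ := (hG.preconnected w v).exists_walk_length_eq_dist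
    have hl : (P.append Q).length = G.dist u v := by
      rw [SimpleGraph.Walk.length_append, hP, hQ, hd]
    exact h u hu v hv _ (SimpleGraph.Walk.isPath_of_length_eq_dist _ hl) hl w (by simp) hw
  · intro h u hu v hv P _ hl w hw hwX
    refine h u hu v hv w hwX (le_antisymm ?_ hG.dist_triangle)
    rw [← hl, ← P.take_spec hw, SimpleGraph.Walk.length_append]
    exact add_le_add (SimpleGraph.dist_le _) (SimpleGraph.dist_le _)

end GeneralPosition

/-! ### Slices and the constraints they impose on each other. -/

section UpperBound

variable {n : ℕ}

/-- No word of `X` lies strictly between two others in the word metric. -/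
def WordGeneralPosition (X : Finset (Fin n → Fin 3)) : Prop :=
  ∀ u ∈ X, ∀ v ∈ X, ∀ w ∈ X, wordDist u w + wordDist w v = wordDist u v → w = u ∨ w = v

/-- No word of `X` lies on the geodesic from another word of `X` to the extreme vertex `a⋯a`. -/
def CornerFree (X : Finset (Fin n → Fin 3)) (a : Fin 3) : Prop :=
  ∀ u ∈ X, ∀ w ∈ X, wordDist u w + cornerDist w a = cornerDist u a → w = u

/-- No word of `X` lies on the geodesic between the extreme vertices `a⋯a` and `b⋯b`. -/
def SideFree (X : Finset (Fin n → Fin 3)) (a b : Fin 3) : Prop :=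
  ∀ w ∈ X, cornerDist w a + cornerDist w b + 1 ≠ 2 ^ n

/-- Every word of `X` is closer to `k⋯k` than to `i⋯i`, by at least `2`. -/
def Leaning (X : Finset (Fin n → Fin 3)) (i k : Fin 3) : Prop :=
  ∀ z ∈ X, cornerDist z k + 2 ≤ cornerDist z i

/-- The words `u` such that `iu` is in `X`. -/
def wordSlice (X : Finset (Fin (n + 1) → Fin 3)) (i : Fin 3) : Finset (Fin n → Fin 3) :=
  Finset.univ.filter fun u => vecCons i u ∈ X

theorem mem_wordSlice {X : Finset (Fin (n + 1) → Fin 3)} {i : Fin 3} {u : Fin n → Fin 3} :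
    u ∈ wordSlice X i ↔ vecCons i u ∈ X := by
  simp [wordSlice]

theorem card_wordSlice (X : Finset (Fin (n + 1) → Fin 3)) (i : Fin 3) :
    (wordSlice X i).card = (X.filter fun u => u 0 = i).card := by
  refine Finset.card_bij (fun u _ => vecCons i u) (fun u hu => ?_) (fun u _ v _ h => ?_)
    fun w hw => ?_
  · simpa using mem_wordSlice.1 hu
  · exact (vecCons_eq_vecCons_iff.1 h).2
  · obtain ⟨j, w, rfl⟩ := exists_eq_vecCons w
    obtain ⟨hX, h⟩ := Finset.mem_filter.1 hw
    obtain rfl : j = i := h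
    exact ⟨w, mem_wordSlice.2 hX, rfl⟩

theorem sum_card_wordSlice (X : Finset (Fin (n + 1) → Fin 3)) :
    ∑ i, (wordSlice X i).card = X.card := by
  simp only [card_wordSlice]
  exact (Finset.card_eq_sum_card_fiberwise fun u _ => Finset.mem_coe.2 (Finset.mem_univ (u 0))).symm

theorem sum_eq_of_distinct {i j k : Fin 3} (hij : i ≠ j) (hik : i ≠ k) (hjk : j ≠ k)
    (f : Fin 3 → ℕ) : ∑ l, f l = f i + f j + f k := by
  have : (Finset.univ : Finset (Fin 3)) = {i, j, k} := by
    ext l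
    simpa using eq_or_eq_or_eq_of_distinct hij hik hjk l
  rw [this, Finset.sum_insert (by simp [hij, hik]), Finset.sum_insert (by simp [hjk]),
    Finset.sum_singleton, add_assoc]

theorem card_eq_wordSlice_add {i j k : Fin 3} (hij : i ≠ j) (hik : i ≠ k) (hjk : j ≠ k)
    (X : Finset (Fin (n + 1) → Fin 3)) :
    X.card = (wordSlice X i).card + (wordSlice X j).card + (wordSlice X k).card := by
  rw [← sum_card_wordSlice, sum_eq_of_distinct hij hik hjk]

theorem card_eq_indicator_add {i j k : Fin 3} (hij : i ≠ j) (hik : i ≠ k) (hjk : j ≠ k)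
    (A : Finset (Fin 3)) :
    A.card = (if i ∈ A then 1 else 0) + (if j ∈ A then 1 else 0) + (if k ∈ A then 1 else 0) := by
  rw [← sum_eq_of_distinct hij hik hjk fun l => if l ∈ A then 1 else 0]
  simp

variable {X : Finset (Fin (n + 1) → Fin 3)} {i j k a b : Fin 3}

theorem WordGeneralPosition.wordSlice (hX : WordGeneralPosition X) (i : Fin 3) :
    WordGeneralPosition (wordSlice X i) := by
  intro u hu v hv w hw h
  have := hX _ (mem_wordSlice.1 hu) _ (mem_wordSlice.1 hv) _ (mem_wordSlice.1 hw)
    (by simpa only [wordDist_vecCons_self] using h)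
  simpa only [vecCons_eq_vecCons_iff, true_and] using this

theorem CornerFree.wordSlice (hX : CornerFree X a) (i : Fin 3) :
    CornerFree (wordSlice X i) a := by
  intro u hu w hw h
  have := hX _ (mem_wordSlice.1 hu) _ (mem_wordSlice.1 hw)
    (by rw [wordDist_vecCons_self, cornerDist_vecCons, cornerDist_vecCons]; omega)
  exact (vecCons_eq_vecCons_iff.1 this).2

theorem SideFree.symm (hX : SideFree X a b) : SideFree X b a := fun w hw h =>
  hX w hw (by omega)

theorem SideFree.wordSlice (hab : a ≠ b) (hX : SideFree X a b) :
    SideFree (wordSlice X a) a b := by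
  intro w hw h
  refine hX _ (mem_wordSlice.1 hw) ?_
  rw [cornerDist_vecCons_self, cornerDist_vecCons_of_ne hab, pow_succ]
  omega

/-- If `a⋯a` is a forbidden target and the slice at `b` is nonempty, then all geodesics from
there to `a⋯a` run along the side of the slice at `a`. -/
theorem CornerFree.sideFree_wordSlice (hab : a ≠ b) (hX : CornerFree X a)
    (hb : (_root_.wordSlice X b).Nonempty) : SideFree (_root_.wordSlice X a) a b := by
  intro w hw h
  obtain ⟨v, hv⟩ := hb
  obtain ⟨k, hak, hbk⟩ := exists_distinct_third hab
  have hd := wordDist_vecCons_of_ne hab.symm hbk hak v w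
  have ht := cornerDist_triangle (vecCons b v) (vecCons a w) a
  have := hX _ (mem_wordSlice.1 hv) _ (mem_wordSlice.1 hw) (by
    rw [cornerDist_vecCons_self, cornerDist_vecCons_of_ne hab.symm] at *
    omega)
  exact hab (vecCons_eq_vecCons_iff.1 this).1

/-- If the corner of the slice at `i` next to the nonempty slice at `j` is not a forbidden target,
then some word `iy` reaches all words of `X` starting with `j` only through `k`. -/
theorem WordGeneralPosition.exists_detour (hX : WordGeneralPosition X) (hij : i ≠ j)
    (hik : i ≠ k) (hjk : j ≠ k) (h : ¬ CornerFree (_root_.wordSlice X i) j) :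
    ∃ y ∈ _root_.wordSlice X i, ∀ z ∈ _root_.wordSlice X j,
      cornerDist y k + 2 ^ n + cornerDist z k < cornerDist y j + cornerDist z i := by
  simp only [CornerFree, not_forall] at h
  obtain ⟨y, hy, w, hw, hd, hne⟩ := h
  refine ⟨y, hy, fun z hz => ?_⟩
  -- If the direct route to `z` were optimal, then `w`, which lies on the way from `y` to the corner
  -- `j⋯j`, would lie between `iy` and `jz`.
  by_contra! hle
  have h₁ := wordDist_vecCons_of_ne hij hik hjk y z
  have h₂ := wordDist_vecCons_of_ne hij hik hjk w z
  have h₃ := wordDist_vecCons_self i y w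
  have h₄ := wordDist_triangle (vecCons i y) (vecCons i w) (vecCons j z)
  rcases hX _ (mem_wordSlice.1 hy) _ (mem_wordSlice.1 hz) _ (mem_wordSlice.1 hw) (by omega)
    with h | h
  · exact hne (vecCons_eq_vecCons_iff.1 h).2
  · exact hij (vecCons_eq_vecCons_iff.1 h).1

/-- The margin `2` in `Leaning` combines two strict inequalities: the detour is strictly shorter,
and a corner distance is below `2^n`. -/
theorem WordGeneralPosition.cornerFree_or_leaning (hX : WordGeneralPosition X) (hij : i ≠ j)
    (hik : i ≠ k) (hjk : j ≠ k) :
    CornerFree (_root_.wordSlice X i) j ∨ Leaning (_root_.wordSlice X j) i k := by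
  by_contra! h
  obtain ⟨y, -, hy⟩ := hX.exists_detour hij hik hjk h.1
  refine h.2 fun z hz => ?_
  have := hy z hz
  have := cornerDist_lt y j
  omega

/-- If some word of the slice at `j` is closer to `k` than to `i`, then the corner of the slice at
`k` next to the slice at `j` is a forbidden target. -/
theorem WordGeneralPosition.cornerFree_of_lt (hX : WordGeneralPosition X) (hij : i ≠ j)
    (hik : i ≠ k) (hjk : j ≠ k) {z : Fin n → Fin 3} (hz : z ∈ _root_.wordSlice X j)
    (h : cornerDist z k ≤ cornerDist z i) : CornerFree (_root_.wordSlice X k) j := by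
  by_contra hc
  obtain ⟨w, -, hw⟩ := hX.exists_detour hjk.symm hik.symm hij.symm hc
  have := hw z hz
  have := cornerDist_lt w j
  omega

theorem WordGeneralPosition.cornerFree_of_leaning (hX : WordGeneralPosition X) (hij : i ≠ j)
    (hik : i ≠ k) (hjk : j ≠ k) (h : Leaning (_root_.wordSlice X j) i k)
    (hk : (_root_.wordSlice X k).Nonempty) : CornerFree (_root_.wordSlice X j) k := by
  by_contra hc
  obtain ⟨z, hz, hz'⟩ := hX.exists_detour hjk hij.symm hik.symm hc
  obtain ⟨w, hw⟩ := hk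
  have := hz' w hw
  have := h z hz
  have := cornerDist_lt w j
  omega

end UpperBound

/-! ### Finite checks for words of length two. -/

section BaseCase

/-- The words of length two, in lexicographic order. -/
def twoLetterWord : Fin 9 → Fin 2 → Fin 3 :=
  ![![0, 0], ![0, 1], ![0, 2], ![1, 0], ![1, 1], ![1, 2], ![2, 0], ![2, 1], ![2, 2]]

/-- Triples `(u, w, v)` of words of length two with `w` strictly between `u` and `v`. -/
def betweenTriples : List (Fin 9 × Fin 9 × Fin 9) :=
  [(0, 6, 8), (1, 3, 4), (1, 2, 8), (2, 1, 3), (2, 1, 4), (2, 3, 4), (2, 6, 5), (2, 7, 5),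
    (2, 6, 7), (3, 5, 6), (3, 7, 6), (3, 5, 7), (3, 5, 8), (3, 7, 8), (4, 5, 6), (4, 7, 6),
    (4, 5, 7), (4, 5, 8), (4, 7, 8), (5, 7, 6), (5, 7, 8)]

/-- Pairs `(u, w)` of words of length two with `w` on the geodesic from `u` to a corner. -/
def cornerPairs : Fin 3 → List (Fin 9 × Fin 9) :=
  ![[(3, 1), (4, 1), (4, 3), (5, 0), (6, 2), (7, 0), (8, 2), (8, 6)],
    [(0, 1), (0, 3), (1, 3), (2, 1), (2, 3), (2, 4), (6, 4), (6, 5), (6, 7), (7, 5), (8, 4),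
      (8, 5), (8, 7)],
    [(0, 2), (0, 6), (1, 2), (1, 6), (1, 8), (3, 5), (3, 7), (3, 8), (4, 5), (4, 7), (4, 8),
      (5, 7), (6, 8)]]

theorem twoLetterWord_bijective : Function.Bijective twoLetterWord :=
  (Fintype.bijective_iff_injective_and_card _).2 ⟨by decide +kernel, by simp⟩

/-- Only validity of the listed obstructions matters: neither they nor `cornerPairs` are exhaustive,
but they already force the bounds in `boolCount_le`. -/
theorem betweenTriples_spec : ∀ t ∈ betweenTriples,
    wordDist (twoLetterWord t.1) (twoLetterWord t.2.1) +
      wordDist (twoLetterWord t.2.1) (twoLetterWord t.2.2) =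
        wordDist (twoLetterWord t.1) (twoLetterWord t.2.2) ∧ t.2.1 ≠ t.1 ∧ t.2.1 ≠ t.2.2 := by
  decide +kernel

theorem cornerPairs_spec : ∀ a, ∀ t ∈ cornerPairs a,
    wordDist (twoLetterWord t.1) (twoLetterWord t.2) + cornerDist (twoLetterWord t.2) a =
      cornerDist (twoLetterWord t.1) a ∧ t.2 ≠ t.1 := by
  decide

/-- Whether the set with the given characteristic function avoids all `betweenTriples`. -/
def avoidsTriples (p : Fin 9 → Bool) : Bool :=
  betweenTriples.all fun t => !(p t.1 && p t.2.1 && p t.2.2)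

/-- Whether the set with the given characteristic function avoids all `cornerPairs`. -/
def avoidsPairs (p : Fin 9 → Bool) (a : Fin 3) : Bool :=
  (cornerPairs a).all fun t => !(p t.1 && p t.2)

/-- The size of the set with the given characteristic function. -/
def boolCount (p : Fin 9 → Bool) : ℕ :=
  (List.finRange 9).countP p

theorem boolCount_le_of_bool : ∀ b₀ b₁ b₂ b₃ b₄ b₅ b₆ b₇ b₈ : Bool,
    let p := ![b₀, b₁, b₂, b₃, b₄, b₅, b₆, b₇, b₈]
    avoidsTriples p = true → boolCount p ≤ 4 ∧ (∀ a, avoidsPairs p a = true → boolCount p ≤ 3) ∧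
      ∀ a b, a ≠ b → avoidsPairs p a = true → avoidsPairs p b = true → boolCount p ≤ 2 := by
  decide +kernel

theorem boolCount_le (p : Fin 9 → Bool) (hp : avoidsTriples p = true) :
    boolCount p ≤ 4 ∧ (∀ a, avoidsPairs p a = true → boolCount p ≤ 3) ∧
      ∀ a b, a ≠ b → avoidsPairs p a = true → avoidsPairs p b = true → boolCount p ≤ 2 := by
  have h := boolCount_le_of_bool (p 0) (p 1) (p 2) (p 3) (p 4) (p 5) (p 6) (p 7) (p 8)
  have hq : ![p 0, p 1, p 2, p 3, p 4, p 5, p 6, p 7, p 8] = p := by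
    funext x; fin_cases x <;> rfl
  rw [hq] at h
  exact h hp

theorem boolCount_eq_card (X : Finset (Fin 2 → Fin 3)) :
    boolCount (fun x => decide (twoLetterWord x ∈ X)) = X.card := by
  rw [show X.card = ∑ u, if u ∈ X then 1 else 0 by simp,
    ← twoLetterWord_bijective.sum_comp fun u => if u ∈ X then 1 else 0, boolCount,
    Fin.sum_univ_def, List.countP_eq_length_filter]
  generalize List.finRange 9 = l
  induction l with
  | nil => rfl
  | cons x l ih =>
    by_cases hx : twoLetterWord x ∈ X
    · simp [hx, ← ih, add_comm]
    · simp [hx, ← ih]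

theorem card_add_card_le_of_length_two {X : Finset (Fin 2 → Fin 3)} (hX : WordGeneralPosition X)
    {A : Finset (Fin 3)} (hA : A.card ≤ 2) (hc : ∀ a ∈ A, CornerFree X a) :
    X.card + A.card ≤ 4 := by
  have hp : avoidsTriples (fun x => decide (twoLetterWord x ∈ X)) = true := by
    refine List.all_eq_true.2 fun t ht => ?_
    obtain ⟨hd, h₁, h₂⟩ := betweenTriples_spec t ht
    by_contra h
    simp only [Bool.not_eq_true', Bool.not_eq_false, Bool.and_eq_true, decide_eq_true_eq] at h
    rcases hX _ h.1.1 _ h.2 _ h.1.2 hd with h | h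
    · exact h₁ (twoLetterWord_bijective.1 h)
    · exact h₂ (twoLetterWord_bijective.1 h)
  have hq : ∀ a ∈ A, avoidsPairs (fun x => decide (twoLetterWord x ∈ X)) a = true := by
    refine fun a ha => List.all_eq_true.2 fun t ht => ?_
    obtain ⟨hd, h₁⟩ := cornerPairs_spec a t ht
    by_contra h
    simp only [Bool.not_eq_true', Bool.not_eq_false, Bool.and_eq_true, decide_eq_true_eq] at h
    exact h₁ (twoLetterWord_bijective.1 (hc a ha _ h.1 _ h.2 hd))
  obtain ⟨h₀, h₁, h₂⟩ := boolCount_le _ hp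
  rw [boolCount_eq_card] at h₀ h₁ h₂
  obtain h | h | h : A.card = 0 ∨ A.card = 1 ∨ A.card = 2 := by omega
  · omega
  · obtain ⟨a, rfl⟩ := Finset.card_eq_one.1 h
    have := h₁ a (hq a (by simp))
    omega
  · obtain ⟨a, b, hab, rfl⟩ := Finset.card_eq_two.1 h
    have := h₂ a b hab (hq a (by simp)) (hq b (by simp))
    omega

/-- Off the two sides at `c` only `ab` and `ba` remain, and `ab` lies on the way from `ba` to `aa`.
-/
theorem card_le_one_of_sideFree {X : Finset (Fin 2 → Fin 3)} {c a b : Fin 3} (hca : c ≠ a)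
    (hcb : c ≠ b) (hab : a ≠ b) (hX : CornerFree X a) (ha : SideFree X c a)
    (hb : SideFree X c b) : X.card ≤ 1 := by
  have key : ∀ c a b : Fin 3, c ≠ a → c ≠ b → a ≠ b →
      ∀ w : Fin 2 → Fin 3, cornerDist w c + cornerDist w a + 1 ≠ 2 ^ 2 →
        cornerDist w c + cornerDist w b + 1 ≠ 2 ^ 2 → w = ![a, b] ∨ w = ![b, a] := by
    decide
  have key' : ∀ a b : Fin 3, a ≠ b →
      wordDist ![b, a] ![a, b] + cornerDist ![a, b] a = cornerDist ![b, a] a := by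
    decide
  have hw := key c a b hca hcb hab
  have hd := key' a b hab
  refine Finset.card_le_one.2 fun u hu v hv => ?_
  rcases hw u (ha u hu) (hb u hu) with rfl | rfl <;> rcases hw v (ha v hv) (hb v hv) with rfl | rfl
  · rfl
  · exact hX _ hv _ hu hd
  · exact (hX _ hu _ hv hd).symm
  · rfl

theorem eq_or_eq_of_leaning {X : Finset (Fin 2 → Fin 3)} {i j k : Fin 3} (hij : i ≠ j)
    (hik : i ≠ k) (hjk : j ≠ k) (hX : Leaning X i k) :
    ∀ z ∈ X, z = ![k, k] ∨ z = ![k, j] := by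
  have key : ∀ i j k : Fin 3, i ≠ j → i ≠ k → j ≠ k → ∀ z : Fin 2 → Fin 3,
      cornerDist z k + 2 ≤ cornerDist z i → z = ![k, k] ∨ z = ![k, j] := by
    decide
  exact fun z hz => key i j k hij hik hjk z (hX z hz)

theorem card_le_two_of_leaning {X : Finset (Fin 2 → Fin 3)} {i j k : Fin 3} (hij : i ≠ j)
    (hik : i ≠ k) (hjk : j ≠ k) (hX : Leaning X i k) : X.card ≤ 2 :=
  (Finset.card_le_card fun z hz => by
    simpa using eq_or_eq_of_leaning hij hik hjk hX z hz).trans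
      (Finset.card_le_two (a := ![k, k]) (b := ![k, j]))

theorem card_le_one_of_leaning {X : Finset (Fin 2 → Fin 3)} {i j k : Fin 3} (hij : i ≠ j)
    (hik : i ≠ k) (hjk : j ≠ k) (hX : Leaning X i k) (hk : CornerFree X k) : X.card ≤ 1 := by
  have key : ∀ j k : Fin 3, j ≠ k →
      wordDist ![k, j] ![k, k] + cornerDist ![k, k] k = cornerDist ![k, j] k := by
    decide
  have hw := eq_or_eq_of_leaning hij hik hjk hX
  have hd := key j k hjk
  refine Finset.card_le_one.2 fun u hu v hv => ?_
  rcases hw u hu with rfl | rfl <;> rcases hw v hv with rfl | rfl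
  · rfl
  · exact hk _ hv _ hu hd
  · exact (hk _ hu _ hv hd).symm
  · rfl

end BaseCase

/-! ### Simultaneous induction for the three upper bounds. -/

section UpperBoundInduction

/-- Upper bounds, for words of length `r + 2`, on the size of a set in general position subject to
constraints at the corners and sides of `S_3^(r+2)`. -/
structure WordUpperBounds (r : ℕ) : Prop where
  card_add_card_le : ∀ X : Finset (Fin (r + 2) → Fin 3), WordGeneralPosition X →
    ∀ A : Finset (Fin 3), A.card ≤ 2 → (∀ a ∈ A, CornerFree X a) → X.card + A.card ≤ 3 ^ r + 3
  card_le_of_sideFree : ∀ X : Finset (Fin (r + 2) → Fin 3), WordGeneralPosition X →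
    (∀ a, CornerFree X a) → ∀ c a b : Fin 3, c ≠ a → c ≠ b → a ≠ b → SideFree X c a →
      SideFree X c b → X.card ≤ 3 ^ r
  card_le_of_leaning : ∀ X : Finset (Fin (r + 2) → Fin 3), WordGeneralPosition X →
    ∀ i j k : Fin 3, i ≠ j → i ≠ k → j ≠ k → Leaning X i k → CornerFree X k → X.card ≤ 3 ^ r

theorem wordUpperBounds_zero : WordUpperBounds 0 where
  card_add_card_le _ hX _ hA hc := card_add_card_le_of_length_two hX hA hc
  card_le_of_sideFree _ _ hc _ a _ hca hcb hab ha hb :=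
    card_le_one_of_sideFree hca hcb hab (hc a) ha hb
  card_le_of_leaning _ _ _ _ _ hij hik hjk hl hk := card_le_one_of_leaning hij hik hjk hl hk

namespace WordUpperBounds

variable {r : ℕ}

theorem card_le_of_leaning_succ (ih : WordUpperBounds r) {X : Finset (Fin (r + 3) → Fin 3)} {i j k : Fin 3}
    (hX : WordGeneralPosition X) (hij : i ≠ j) (hik : i ≠ k) (hjk : j ≠ k)
    (hl : Leaning X i k) (hk : CornerFree X k) : X.card ≤ 3 ^ (r + 1) := by
  have hi : wordSlice X i = ∅ := by
    refine Finset.eq_empty_of_forall_notMem fun u hu => ?_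
    have := hl _ (mem_wordSlice.1 hu)
    rw [cornerDist_vecCons_self, cornerDist_vecCons_of_ne hik] at this
    have := cornerDist_lt u i
    omega
  have hlj : Leaning (wordSlice X j) i k := by
    intro z hz
    have := hl _ (mem_wordSlice.1 hz)
    rw [cornerDist_vecCons_of_ne hij.symm, cornerDist_vecCons_of_ne hjk] at this
    omega
  have hj := ih.card_le_of_leaning _ (hX.wordSlice j) i j k hij hik hjk hlj (hk.wordSlice j)
  have hcard := card_eq_wordSlice_add hij hik hjk X
  rw [hi, Finset.card_empty] at hcard
  have hp := Nat.one_le_pow r 3 (by norm_num)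
  rw [pow_succ]
  -- Slices `j` and `k` have at most `0` and `3^r + 2` words, or `3^r` and `3^r + 1`; both totals
  -- are at most `3^(r+1)`.
  rcases (wordSlice X j).eq_empty_or_nonempty with he | ⟨z, hz⟩
  · have := ih.card_add_card_le _ (hX.wordSlice k) {k} (by simp) (by simpa using hk.wordSlice k)
    rw [he, Finset.card_empty] at hcard
    rw [Finset.card_singleton] at this
    omega
  · have hkj := hX.cornerFree_of_lt hij hik hjk hz (by have := hlj z hz; omega)
    have := ih.card_add_card_le _ (hX.wordSlice k) {j, k} (by rw [Finset.card_pair hjk])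
      (by simpa using ⟨hkj, hk.wordSlice k⟩)
    rw [Finset.card_pair hjk] at this
    omega

/-- Two corners give `3^r + 1`. If also `i ∈ A`, geodesics from the other two slices to `i⋯i` run
along both sides at that corner, and the `SideFree` bound saves one more. -/
theorem card_wordSlice_add_le (ih : WordUpperBounds r) {X : Finset (Fin (r + 3) → Fin 3)} {i j k : Fin 3}
    (hX : WordGeneralPosition X) (hij : i ≠ j) (hik : i ≠ k) (hjk : j ≠ k) {A : Finset (Fin 3)}
    (hA : ∀ a ∈ A, CornerFree X a) (hj : (wordSlice X j).Nonempty) (hk : (wordSlice X k).Nonempty)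
    (hcj : CornerFree (wordSlice X i) j) (hck : CornerFree (wordSlice X i) k) :
    (wordSlice X i).card + (if i ∈ A then 1 else 0) ≤ 3 ^ r + 1 := by
  split_ifs with hi
  · have := ih.card_le_of_sideFree _ (hX.wordSlice i)
      (fun a => by
        rcases eq_or_eq_or_eq_of_distinct hij hik hjk a with rfl | rfl | rfl
        · exact (hA _ hi).wordSlice _
        · exact hcj
        · exact hck)
      i j k hij hik hjk ((hA i hi).sideFree_wordSlice hij hj) ((hA i hi).sideFree_wordSlice hik hk)
    omega
  · have := ih.card_add_card_le _ (hX.wordSlice i) {j, k} (by rw [Finset.card_pair hjk])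
      (by simpa using ⟨hcj, hck⟩)
    rw [Finset.card_pair hjk] at this
    omega

theorem card_add_card_le_of_not_cornerFree (ih : WordUpperBounds r) {X : Finset (Fin (r + 3) → Fin 3)} {i j k : Fin 3}
    (hX : WordGeneralPosition X) (hij : i ≠ j) (hik : i ≠ k) (hjk : j ≠ k) {A : Finset (Fin 3)}
    (hA : ∀ a ∈ A, CornerFree X a) (hi : (wordSlice X i).Nonempty)
    (hj : (wordSlice X j).Nonempty) (hk : (wordSlice X k).Nonempty)
    (h : ¬ CornerFree (wordSlice X i) j) : X.card + A.card ≤ 3 ^ (r + 1) + 3 := by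
  have hjA : j ∉ A := fun hj => h ((hA j hj).wordSlice i)
  have hl := (hX.cornerFree_or_leaning hij hik hjk).resolve_left h
  have hjk' := hX.cornerFree_of_leaning hij hik hjk hl hk
  have hj' := ih.card_le_of_leaning _ (hX.wordSlice j) i j k hij hik hjk hl hjk'
  have hcard := card_eq_wordSlice_add hij hik hjk X
  have hAcard := card_eq_indicator_add hij hik hjk A
  rw [if_neg hjA] at hAcard
  rw [pow_succ]
  -- If so, slices `i`, `j`, `k`, counted with their members of `A`, have budgets `3^r + 2`, `3^r`,
  -- `3^r + 1`. If not, slices `j` and `k` both lean, and the budgets are `3^r + 3`, `3^r`, `3^r`.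
  by_cases hc : CornerFree (wordSlice X i) k
  · obtain ⟨z, hz⟩ := hj
    obtain ⟨y, hy, hyz⟩ := hX.exists_detour hij hik hjk h
    have hkj := hX.cornerFree_of_lt hij hik hjk hz (by have := hl z hz; omega)
    have hki := hX.cornerFree_of_lt hij.symm hjk hik hy
      (by have := hyz z hz; have := cornerDist_lt z i; omega)
    have hk' := ih.card_wordSlice_add_le hX hik.symm hjk.symm hij hA hi ⟨z, hz⟩ hki hkj
    have hi' : (wordSlice X i).card + (if i ∈ A then 1 else 0) ≤ 3 ^ r + 2 := by
      split_ifs with hiA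
      · have := ih.card_add_card_le _ (hX.wordSlice i) {i, k} (by rw [Finset.card_pair hik])
          (by simpa using ⟨(hA i hiA).wordSlice i, hc⟩)
        rw [Finset.card_pair hik] at this
        omega
      · have := ih.card_add_card_le _ (hX.wordSlice i) {k} (by simp) (by simpa using hc)
        rw [Finset.card_singleton] at this
        omega
    omega
  · have hkA : k ∉ A := fun hk => hc ((hA k hk).wordSlice i)
    have hl' := (hX.cornerFree_or_leaning hik hij hjk.symm).resolve_left hc
    have hkj := hX.cornerFree_of_leaning hik hij hjk.symm hl' hj
    have hk' := ih.card_le_of_leaning _ (hX.wordSlice k) i k j hik hij hjk.symm hl' hkj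
    rw [if_neg hkA] at hAcard
    have hi' := ih.card_add_card_le _ (hX.wordSlice i) (A.filter (· = i))
      ((Finset.card_le_one.2 (by simp +contextual)).trans one_le_two)
      fun a ha => (hA a (Finset.mem_filter.1 ha).1).wordSlice i
    have : (A.filter (· = i)).card = if i ∈ A then 1 else 0 := by
      rw [Finset.filter_eq']; split_ifs <;> simp
    omega

theorem card_add_card_le_of_nonempty (ih : WordUpperBounds r) {X : Finset (Fin (r + 3) → Fin 3)}
    (hX : WordGeneralPosition X) {A : Finset (Fin 3)} (hA : ∀ a ∈ A, CornerFree X a)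
    (hne : ∀ i, (wordSlice X i).Nonempty) : X.card + A.card ≤ 3 ^ (r + 1) + 3 := by
  by_cases h : ∃ i j, i ≠ j ∧ ¬ CornerFree (wordSlice X i) j
  · obtain ⟨i, j, hij, h⟩ := h
    obtain ⟨k, hik, hjk⟩ := exists_distinct_third hij
    exact ih.card_add_card_le_of_not_cornerFree hX hij hik hjk hA (hne i) (hne j) (hne k) h
  push Not at h
  have key {i j k : Fin 3} (hij : i ≠ j) (hik : i ≠ k) (hjk : j ≠ k) :=
    ih.card_wordSlice_add_le hX hij hik hjk hA (hne j) (hne k) (h i j hij) (h i k hik)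
  have h01 : (0 : Fin 3) ≠ 1 := by decide
  have h02 : (0 : Fin 3) ≠ 2 := by decide
  have h12 : (1 : Fin 3) ≠ 2 := by decide
  have h₀ := key h01 h02 h12
  have h₁ := key h01.symm h12 h02
  have h₂ := key h02.symm h12.symm h01
  have hcard := card_eq_wordSlice_add h01 h02 h12 X
  have hAcard := card_eq_indicator_add h01 h02 h12 A
  rw [pow_succ]
  omega

theorem card_add_card_le_of_slice_eq_empty (ih : WordUpperBounds r) {X : Finset (Fin (r + 3) → Fin 3)} {i j k : Fin 3}
    (hX : WordGeneralPosition X) (hij : i ≠ j) (hik : i ≠ k) (hjk : j ≠ k)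
    {A : Finset (Fin 3)} (hA2 : A.card ≤ 2) (hA : ∀ a ∈ A, CornerFree X a)
    (hk : wordSlice X k = ∅) : X.card + A.card ≤ 3 ^ (r + 1) + 3 := by
  have hcard := card_eq_wordSlice_add hij hik hjk X
  rw [hk, Finset.card_empty] at hcard
  have hi := ih.card_add_card_le _ (hX.wordSlice i) A hA2 fun a ha => (hA a ha).wordSlice i
  have hj := ih.card_add_card_le _ (hX.wordSlice j) A hA2 fun a ha => (hA a ha).wordSlice j
  -- Adding the two slice bounds suffices exactly under this inequality; it fails only for `r = 0`
  -- and `|A| ≤ 1`.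
  by_cases hr : 3 ≤ 3 ^ r + A.card
  · rw [pow_succ]
    omega
  obtain rfl : r = 0 := by
    by_contra h
    have := Nat.pow_le_pow_right (n := 3) (by norm_num) (Nat.one_le_iff_ne_zero.2 h)
    omega
  norm_num at hi hj hr ⊢
  rcases hX.cornerFree_or_leaning hij hik hjk with hci | hl
  · rcases hX.cornerFree_or_leaning hij.symm hjk hik with hcj | hl
    · have key (l m : Fin 3) (h : CornerFree (wordSlice X l) m) :
          (wordSlice X l).card + (insert m A).card ≤ 4 := by
        refine ih.card_add_card_le _ (hX.wordSlice l) (insert m A)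
          ((Finset.card_insert_le _ _).trans (by omega)) ?_
        simpa using ⟨h, fun a ha => (hA a ha).wordSlice l⟩
      have h₁ := key i j hci
      have h₂ := key j i hcj
      -- This yields `|A ∪ {i}| + |A ∪ {j}| ≥ |A| + 2`, the saving needed from `4 + 4`.
      have h₃ := Finset.card_union_add_card_inter (insert i A) (insert j A)
      have h₄ : A.card ≤ (insert i A ∩ insert j A).card :=
        Finset.card_le_card (Finset.subset_inter (Finset.subset_insert _ _)
          (Finset.subset_insert _ _))
      have h₅ : 2 ≤ (insert i A ∪ insert j A).card := by
        rw [← Finset.card_pair hij]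
        exact Finset.card_le_card (by simp [Finset.insert_subset_iff])
      omega
    · have := card_le_two_of_leaning hij.symm hjk hik hl
      omega
  · have := card_le_two_of_leaning hij hik hjk hl
    omega

theorem card_le_of_sideFree_succ (ih : WordUpperBounds r) {X : Finset (Fin (r + 3) → Fin 3)} {a b c : Fin 3}
    (hX : WordGeneralPosition X) (hX' : ∀ x, CornerFree X x) (hca : c ≠ a) (hcb : c ≠ b)
    (hab : a ≠ b) (ha : SideFree X c a) (hb : SideFree X c b) : X.card ≤ 3 ^ (r + 1) := by
  have hcard := card_eq_wordSlice_add hca hcb hab X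
  have hp := Nat.one_le_pow r 3 (by norm_num)
  have h_all (l : Fin 3) : (wordSlice X l).card ≤ 3 ^ r + 1 := by
    have := ih.card_add_card_le _ (hX.wordSlice l) {c, a} (by rw [Finset.card_pair hca])
      (fun x _ => (hX' x).wordSlice l)
    rw [Finset.card_pair hca] at this
    omega
  have hc := ih.card_le_of_sideFree _ (hX.wordSlice c) (fun x => (hX' x).wordSlice c) c a b
    hca hcb hab (ha.wordSlice hca) (hb.wordSlice hcb)
  -- Slice `x` inherits the side towards `c`; a nonempty slice `y` makes it avoid the side towards
  -- `y` too.
  have key {x y : Fin 3} (hcx : c ≠ x) (hcy : c ≠ y) (hxy : x ≠ y) (hx : SideFree X c x)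
      (hy : (wordSlice X y).Nonempty) : (wordSlice X x).card ≤ 3 ^ r :=
    ih.card_le_of_sideFree _ (hX.wordSlice x) (fun z => (hX' z).wordSlice x) x c y
      hcx.symm hxy hcy (hx.symm.wordSlice hcx.symm) ((hX' x).sideFree_wordSlice hxy hy)
  have hA := h_all a
  have hB := h_all b
  rw [pow_succ]
  rcases (wordSlice X a).eq_empty_or_nonempty with h | h
  · rw [h, Finset.card_empty] at hcard
    omega
  rcases (wordSlice X b).eq_empty_or_nonempty with h' | h'
  · rw [h', Finset.card_empty] at hcard
    omega
  have := key hca hcb hab ha h'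
  have := key hcb hca hab.symm hb h
  omega

theorem succ (ih : WordUpperBounds r) : WordUpperBounds (r + 1) where
  card_add_card_le X hX A hA2 hA := by
    by_cases hne : ∀ i, (wordSlice X i).Nonempty
    · exact ih.card_add_card_le_of_nonempty hX hA hne
    · push Not at hne
      obtain ⟨k, hk⟩ := hne
      have h₁ : k + 1 ≠ k + 2 ∧ k + 1 ≠ k ∧ k + 2 ≠ k := by clear hk; revert k; decide
      exact ih.card_add_card_le_of_slice_eq_empty hX h₁.1 h₁.2.1 h₁.2.2 hA2 hA hk
  card_le_of_sideFree X hX hX' c a b hca hcb hab ha hb :=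
    ih.card_le_of_sideFree_succ hX hX' hca hcb hab ha hb
  card_le_of_leaning X hX i j k hij hik hjk hl hk :=
    ih.card_le_of_leaning_succ hX hij hik hjk hl hk

end WordUpperBounds

theorem wordUpperBounds (r : ℕ) : WordUpperBounds r := by
  induction r with
  | zero => exact wordUpperBounds_zero
  | succ r ih => exact ih.succ

theorem WordGeneralPosition.card_le {r : ℕ} {X : Finset (Fin (r + 2) → Fin 3)}
    (hX : WordGeneralPosition X) : X.card ≤ 3 ^ r + 3 := by
  simpa using (wordUpperBounds r).card_add_card_le X hX ∅ (by simp) (by simp)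

end UpperBoundInduction

/-! ### Construction of an extremal set. -/

section LowerBound

variable {n : ℕ}

/-- The last three letters of `u` are `i`, `i + 1`, `i + 2` for some `i`. -/
def EndsCyclic (u : Fin (n + 3) → Fin 3) : Prop :=
  u ⟨n + 1, by omega⟩ = u ⟨n, by omega⟩ + 1 ∧ u ⟨n + 2, by omega⟩ = u ⟨n, by omega⟩ + 2

instance (u : Fin (n + 3) → Fin 3) : Decidable (EndsCyclic u) :=
  inferInstanceAs (Decidable (_ ∧ _))

theorem endsCyclic_vecCons {i : Fin 3} {u : Fin (n + 3) → Fin 3} :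
    EndsCyclic (vecCons i u) ↔ EndsCyclic u :=
  Iff.rfl

/-- The words ending cyclically, together with the constant words. -/
def cyclicOrConst (n : ℕ) : Finset (Fin (n + 3) → Fin 3) :=
  Finset.univ.filter fun u => EndsCyclic u ∨ ∃ a, u = fun _ => a

theorem mem_cyclicOrConst {u : Fin (n + 3) → Fin 3} :
    u ∈ cyclicOrConst n ↔ EndsCyclic u ∨ ∃ a, u = fun _ => a := by
  simp [cyclicOrConst]

theorem mem_cyclicOrConst_of_vecCons {i : Fin 3} {u : Fin (n + 3) → Fin 3}
    (h : vecCons i u ∈ cyclicOrConst (n + 1)) : u ∈ cyclicOrConst n := by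
  rcases mem_cyclicOrConst.1 h with h | ⟨a, h⟩
  · exact mem_cyclicOrConst.2 (Or.inl h)
  · rw [const_succ_eq_vecCons] at h
    exact mem_cyclicOrConst.2 (Or.inr ⟨a, (vecCons_eq_vecCons_iff.1 h).2⟩)

/-- All three letters occur among the last three, so at least one position adds nothing to the
distance to `a⋯a`. -/
theorem EndsCyclic.cornerDist_add_one_lt {w : Fin (n + 3) → Fin 3} (hw : EndsCyclic w)
    (a : Fin 3) : cornerDist w a + 1 < 2 ^ (n + 3) := by
  induction n with
  | zero => revert w a; decide +kernel
  | succ n ih =>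
    obtain ⟨i, w, rfl⟩ := exists_eq_vecCons w
    have := ih (endsCyclic_vecCons.1 hw)
    rw [cornerDist_vecCons, pow_succ _ (n + 3)]
    split_ifs <;> omega

theorem EndsCyclic.two_pow_lt {w : Fin (n + 3) → Fin 3} (hw : EndsCyclic w) {a b : Fin 3}
    (hab : a ≠ b) : 2 ^ (n + 3) < cornerDist w a + cornerDist w b + 1 := by
  obtain ⟨k, hak, hbk⟩ := exists_distinct_third hab
  have := cornerDist_sum hab hak hbk w
  have := hw.cornerDist_add_one_lt k
  omega

/-- A common first letter is stripped. Otherwise the route through `w` is too long outright, or `w`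
would have to lie on a side of its copy. -/
theorem EndsCyclic.eq_of_wordDist_add_cornerDist {u w : Fin (n + 3) → Fin 3}
    (hu : u ∈ cyclicOrConst n) (hw : EndsCyclic w) {a : Fin 3}
    (h : wordDist u w + cornerDist w a = cornerDist u a) : w = u := by
  induction n with
  | zero =>
    have key : ∀ w : Fin 3 → Fin 3, EndsCyclic (n := 0) w → ∀ u ∈ cyclicOrConst 0, ∀ a,
        wordDist u w + cornerDist w a = cornerDist u a → w = u := by
      decide +kernel
    exact key w hw u hu a h
  | succ n ih =>
    obtain ⟨i, u, rfl⟩ := exists_eq_vecCons u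
    obtain ⟨j, w, rfl⟩ := exists_eq_vecCons w
    replace hu := mem_cyclicOrConst_of_vecCons hu
    replace hw := endsCyclic_vecCons.1 hw
    by_cases hij : i = j
    · subst hij
      rw [wordDist_vecCons_self, cornerDist_vecCons, cornerDist_vecCons] at h
      rw [ih hu hw (by omega)]
    exfalso
    obtain ⟨k, hik, hjk⟩ := exists_distinct_third hij
    rw [wordDist_vecCons_of_ne hij hik hjk] at h
    have := cornerDist_lt u a
    rcases eq_or_eq_or_eq_of_distinct hij hik hjk a with rfl | rfl | rfl
    · rw [cornerDist_vecCons_self, cornerDist_vecCons_of_ne (Ne.symm hij)] at h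
      omega
    · rw [cornerDist_vecCons_self, cornerDist_vecCons_of_ne hij] at h
      have := hw.two_pow_lt hij
      have := hw.two_pow_lt hjk
      omega
    · rw [cornerDist_vecCons_of_ne hik, cornerDist_vecCons_of_ne hjk] at h
      have := hw.two_pow_lt hik
      omega

theorem EndsCyclic.eq_or_eq_of_wordDist_add {u v w : Fin (n + 3) → Fin 3}
    (hu : u ∈ cyclicOrConst n) (hv : v ∈ cyclicOrConst n) (hw : EndsCyclic w)
    (h : wordDist u w + wordDist w v = wordDist u v) : w = u ∨ w = v := by
  induction n with
  | zero =>
    have key : ∀ w : Fin 3 → Fin 3, EndsCyclic (n := 0) w → ∀ u ∈ cyclicOrConst 0,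
        ∀ v ∈ cyclicOrConst 0, wordDist u w + wordDist w v = wordDist u v → w = u ∨ w = v := by
      decide +kernel
    exact key w hw u hu v hv h
  | succ n ih =>
    obtain ⟨i, u, rfl⟩ := exists_eq_vecCons u
    obtain ⟨j, v, rfl⟩ := exists_eq_vecCons v
    obtain ⟨l, w, rfl⟩ := exists_eq_vecCons w
    replace hu := mem_cyclicOrConst_of_vecCons hu
    replace hv := mem_cyclicOrConst_of_vecCons hv
    replace hw := endsCyclic_vecCons.1 hw
    by_cases hij : i = j
    · subst hij
      by_cases hil : i = l
      · subst hil
        simp only [wordDist_vecCons_self] at h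
        simpa only [vecCons_eq_vecCons_iff, true_and] using ih hu hv hw h
      -- Leaving a copy and returning is never geodesic: through one gate it can be cut short,
      -- through two it is longer than `2^n`.
      · exfalso
        obtain ⟨k, hik, hlk⟩ := exists_distinct_third hil
        rw [wordDist_vecCons_self, wordDist_vecCons_of_ne hil hik hlk,
          wordDist_vecCons_of_ne (Ne.symm hil) hlk hik] at h
        have := wordDist_lt u v
        have := wordDist_triangle u (fun _ => l) v
        have := wordDist_triangle u (fun _ => k) v
        have := wordDist_comm (fun _ => l) v
        have := wordDist_comm (fun _ => k) v
        simp only [wordDist_const] at *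
        omega
    obtain ⟨k, hik, hjk⟩ := exists_distinct_third hij
    have hd := wordDist_vecCons_of_ne hij hik hjk u v
    rcases eq_or_eq_or_eq_of_distinct hij hik hjk l with rfl | rfl | rfl
    · left
      rw [wordDist_vecCons_self] at h
      have hd' := wordDist_vecCons_of_ne hij hik hjk w v
      have h₁ := cornerDist_triangle u w j
      have h₂ := cornerDist_triangle u w k
      -- Whichever gate a geodesic from `w` to `v` uses, `w` lies on the way from `u` to that gate.
      have : wordDist u w + cornerDist w j = cornerDist u j ∨
          wordDist u w + cornerDist w k = cornerDist u k := by omega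
      rcases this with h | h <;> rw [EndsCyclic.eq_of_wordDist_add_cornerDist hu hw h]
    · right
      rw [wordDist_vecCons_self] at h
      have hd' := wordDist_vecCons_of_ne hij hik hjk u w
      have h₁ := cornerDist_triangle v w i
      have h₂ := cornerDist_triangle v w k
      rw [wordDist_comm w v] at h
      have : wordDist v w + cornerDist w i = cornerDist v i ∨
          wordDist v w + cornerDist w k = cornerDist v k := by omega
      rcases this with h | h <;> rw [EndsCyclic.eq_of_wordDist_add_cornerDist hv hw h]
    -- A geodesic through the third copy follows its side from `i⋯i` to `j⋯j`, which misses `w`.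
    · exfalso
      have h₁ := wordDist_vecCons_of_ne hik hij hjk.symm u w
      have h₂ := wordDist_vecCons_of_ne hjk.symm hik.symm (Ne.symm hij) w v
      have := hw.two_pow_lt hij
      have := cornerDist_lt u j
      have := cornerDist_lt v i
      omega

/-- The two neighbours of an extreme vertex are adjacent, so a route passing through it can be
shortened. -/
theorem wordDist_lt_cornerDist_add {n : ℕ} {u v : Fin n → Fin 3} {a : Fin 3}
    (hu : cornerDist u a ≠ 0) (hv : cornerDist v a ≠ 0) :
    wordDist u v < cornerDist u a + cornerDist v a := by
  induction n with
  | zero => exact absurd rfl hu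
  | succ n ih =>
    obtain ⟨i, u, rfl⟩ := exists_eq_vecCons u
    obtain ⟨j, v, rfl⟩ := exists_eq_vecCons v
    by_cases hij : i = j
    · subst hij
      rw [wordDist_vecCons_self]
      by_cases hi : i = a
      · subst hi
        rw [cornerDist_vecCons_self] at *
        rw [cornerDist_vecCons_self] at *
        exact ih hu hv
      · rw [cornerDist_vecCons_of_ne hi, cornerDist_vecCons_of_ne hi]
        have := wordDist_lt u v
        omega
    · obtain ⟨k, hik, hjk⟩ := exists_distinct_third hij
      rw [wordDist_vecCons_of_ne hij hik hjk]
      have := cornerDist_lt u j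
      have := cornerDist_lt v i
      rcases eq_or_eq_or_eq_of_distinct hij hik hjk a with rfl | rfl | rfl
      · rw [cornerDist_vecCons_self] at *
        rw [cornerDist_vecCons_of_ne (Ne.symm hij)]
        omega
      · rw [cornerDist_vecCons_self] at *
        rw [cornerDist_vecCons_of_ne hij]
        omega
      · rw [cornerDist_vecCons_of_ne hik, cornerDist_vecCons_of_ne hjk]
        omega

theorem wordGeneralPosition_cyclicOrConst (n : ℕ) : WordGeneralPosition (cyclicOrConst n) := by
  intro u hu v hv w hw h
  rcases mem_cyclicOrConst.1 hw with hw | ⟨a, rfl⟩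
  · exact hw.eq_or_eq_of_wordDist_add hu hv h
  · by_contra! hne
    rw [wordDist_comm _ v, wordDist_const, wordDist_const] at h
    exact (wordDist_lt_cornerDist_add
      (fun h0 => hne.1 (eq_const_of_cornerDist_eq_zero h0).symm)
      fun h0 => hne.2 (eq_const_of_cornerDist_eq_zero h0).symm).ne' h

theorem card_filter_endsCyclic (n : ℕ) :
    (Finset.univ.filter fun u : Fin (n + 3) → Fin 3 => EndsCyclic u).card = 3 ^ (n + 1) := by
  induction n with
  | zero => decide +kernel
  | succ n ih =>
    rw [← sum_card_wordSlice, Finset.sum_congr rfl fun i _ => ?_, Finset.sum_const,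
      Finset.card_univ, Fintype.card_fin, smul_eq_mul, pow_succ', ← ih]
    congr 1
    ext u
    simp [mem_wordSlice, endsCyclic_vecCons]

theorem card_cyclicOrConst (n : ℕ) : (cyclicOrConst n).card = 3 ^ (n + 1) + 3 := by
  rw [cyclicOrConst, Finset.filter_or, Finset.card_union_of_disjoint, card_filter_endsCyclic]
  · congr 1
    have : (Finset.univ.filter fun u : Fin (n + 3) → Fin 3 => ∃ a, u = fun _ => a) =
        Finset.univ.image fun a _ => a := by
      ext u
      simp [eq_comm]
    rw [this, Finset.card_image_of_injective _ fun a b h => congrFun h 0, Finset.card_univ,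
      Fintype.card_fin]
  · refine Finset.disjoint_filter.2 fun u _ hu ⟨a, ha⟩ => ?_
    subst ha
    have key : ∀ a : Fin 3, a ≠ a + 1 := by decide
    exact key a hu.1

theorem exists_wordGeneralPosition (r : ℕ) :
    ∃ X : Finset (Fin (r + 2) → Fin 3), WordGeneralPosition X ∧ X.card = 3 ^ r + 3 := by
  cases r with
  | zero =>
    -- Words of length two are too short for a cyclic ending, so a set of four is given outright.
    refine ⟨{![0, 0], ![0, 2], ![1, 1], ![1, 2]}, ?_, by decide⟩
    unfold WordGeneralPosition
    decide +kernel
  | succ n => exact ⟨_, wordGeneralPosition_cyclicOrConst n, card_cyclicOrConst n⟩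

end LowerBound

theorem isGeneralPosition_coe_iff {n : ℕ} {X : Finset (Fin n → Fin 3)} :
    (sierpinskiGraph 3 n).IsGeneralPosition X ↔ WordGeneralPosition X := by
  simp only [sierpinskiGraph_connected.isGeneralPosition_iff, sierpinskiGraph_dist,
    Finset.mem_coe, WordGeneralPosition]

theorem mainTheorem2 (n : ℕ) (hn : 2 ≤ n) :
    (sierpinskiGraph 3 n).gpNumber = 3 ^ (n - 2) + 3 := by
  obtain ⟨r, rfl⟩ := Nat.exists_eq_add_of_le' hn
  rw [Nat.add_sub_cancel]
  refine IsGreatest.csSup_eq ⟨?_, ?_⟩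
  · obtain ⟨X, hX, hcard⟩ := exists_wordGeneralPosition r
    exact ⟨X, isGeneralPosition_coe_iff.2 hX, by rw [Set.ncard_coe_finset, hcard]⟩
  · rintro _ ⟨X, hX, rfl⟩
    lift X to Finset (Fin (r + 2) → Fin 3) using X.toFinite
    rw [Set.ncard_coe_finset]
    exact (isGeneralPosition_coe_iff.1 hX).card_le
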